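/- Let $k$ be an algebraically closed field of arbitrary characteristic, let $G$ and $H$ be finite groups, and let $\rho\colon G\to \mathrm{GL}(V)$ and $\sigma\colon H\to\mathrm{GL}(W)$ be exact (that is, faithful) irreducible representations over $k$. Let $F$ be the free group on a countably infinite set $Y$ of free generators. An element $u=u(y_1,\dots,y_t)$ of the group algebra $kF$ is an identity of $\rho$ if $u(\rho(h(y_1)),\dots,\rho(h(y_t)))=0$ in $\mathrm{End}(V)$ for every homomorphism $h\colon F\to G$; and similarly for $\sigma$. Suppose that $\rho$ and $\sigma$ have the same identities, i.e. every $u\in kF$ is an identity of $\rho$ if and only if it is an identity of $\sigma$, and that $V$ is a projective $kG$-module. Then $\rho$ and $\sigma$ are similar: there are a group isomorphism $\alpha\colon G\to H$ and a $k$-linear isomorphism $e\colon V\to W$ such that $e\,\rho(g)=\sigma(\alpha(g))\,e$ for all $g\in G$. Moreover, with $m=|G|$ and with pairwise distinct free generators $y_i$ $(1\le i\le m)$, $u_0$, $u_{ij}$ $(1\le i<j\le m)$, the element $$c_m=\sum_{l=1}^m y_l\Bigl(u_0\prod_{1\le i<j\le m}(y_i-y_j)\,u_{ij}\Bigr)y_l^{-1}\in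 kF$$ (the factors of the product being taken in lexicographic order of $(i,j)$) is a central polynomial of $\rho$: it is not an identity of $\rho$, but all its values $c_m(\rho(h(y_1)),\dots)$, $h\in\mathrm{Hom}(F,G)$, are scalar operators on $V$. -/

import Mathlib

namespace RepIdentity

noncomputable section

/-- The group algebra `kF` of the free group `F` on countably many free generators, indexed by
the natural numbers. -/
abbrev FreeGroupAlgebra (k : Type*) [Field k] : Type _ := MonoidAlgebra k (FreeGroup ℕ)

/-- The value `u(ρ(h(y₁)), …, ρ(h(yₜ)))` in `End(V)` of an element `u` of `kF` at the variable
assignment given by a homomorphism `h : F → G`. -/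
def eval {k G V : Type*} [Field k] [Group G] [AddCommGroup V] [Module k V]
    (ρ : Representation k G V) (h : FreeGroup ℕ →* G) (u : FreeGroupAlgebra k) :
    Module.End k V :=
  MonoidAlgebra.lift k (Module.End k V) (FreeGroup ℕ) (ρ.comp h) u

/-- `u` is an identity of `ρ`: all its values vanish. -/
def IsIdentity {k G V : Type*} [Field k] [Group G] [AddCommGroup V] [Module k V]
    (ρ : Representation k G V) (u : FreeGroupAlgebra k) : Prop :=
  ∀ h : FreeGroup ℕ →* G, eval ρ h u = 0

/-- Two representations (possibly of different groups) have the same identities. -/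
def SameIdentities {k G H V W : Type*} [Field k] [Group G] [Group H]
    [AddCommGroup V] [Module k V] [AddCommGroup W] [Module k W]
    (ρ : Representation k G V) (σ : Representation k H W) : Prop :=
  ∀ u : FreeGroupAlgebra k, IsIdentity ρ u ↔ IsIdentity σ u

/-- Representations `ρ` of `G` and `σ` of `H` are similar if there is a group isomorphism
`α : G ≃* H` such that `σ ∘ α` and `ρ` are equivalent representations of `G`. -/
def Similar {k G H V W : Type*} [Field k] [Group G] [Group H]
    [AddCommGroup V] [Module k V] [AddCommGroup W] [Module k W]
    (ρ : Representation k G V) (σ : Representation k H W) : Prop :=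
  ∃ (α : G ≃* H) (e : V ≃ₗ[k] W), ∀ (g : G) (v : V), e (ρ g v) = σ (α g) (e v)

/-- `c` is a central (Laurent) polynomial of `ρ`: it is not an identity of `ρ`, but all its
values are scalar operators. -/
def IsCentralPolynomial {k G V : Type*} [Field k] [Group G] [AddCommGroup V] [Module k V]
    (ρ : Representation k G V) (c : FreeGroupAlgebra k) : Prop :=
  ¬ IsIdentity ρ c ∧
    ∀ h : FreeGroup ℕ →* G, ∃ a : k, eval ρ h c = a • (1 : Module.End k V)

/-- An element of the free group, as an element of its group algebra. -/
def word (k : Type*) [Field k] (f : FreeGroup ℕ) : FreeGroupAlgebra k :=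
  MonoidAlgebra.of k (FreeGroup ℕ) f

/-- The free variables `yᵢ` (`1 ≤ i`). Together with `u₀` and the `uᵢⱼ` (`1 ≤ i < j`) below they
are pairwise distinct free generators, because `Nat.pair` is injective. -/
def yVar (i : ℕ) : FreeGroup ℕ := FreeGroup.of (Nat.pair i i)

/-- The free variable `u₀`. -/
def uZero : FreeGroup ℕ := FreeGroup.of (Nat.pair 0 0)

/-- The free variables `uᵢⱼ` (`1 ≤ i < j`). -/
def uVar (i j : ℕ) : FreeGroup ℕ := FreeGroup.of (Nat.pair i j)

/-- The pairs `(i, j)` with `1 ≤ i < j ≤ m`, in lexicographic order. -/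
def pairs (m : ℕ) : List (ℕ × ℕ) :=
  (List.range' 1 m ×ˢ List.range' 1 m).filter fun p => p.1 < p.2

/-- `C_m = u₀ ∏_{1 ≤ i < j ≤ m} (yᵢ - yⱼ) uᵢⱼ`, the factors taken in lexicographic order. -/
def guardPoly (k : Type*) [Field k] (m : ℕ) : FreeGroupAlgebra k :=
  word k uZero *
    ((pairs m).map fun p => (word k (yVar p.1) - word k (yVar p.2)) * word k (uVar p.1 p.2)).prod

/-- `c_m = ∑_{l=1}^m y_l C_m y_l⁻¹`. -/
def centralPoly (k : Type*) [Field k] (m : ℕ) : FreeGroupAlgebra k :=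
  ∑ l ∈ Finset.Icc 1 m, word k (yVar l) * guardPoly k m * word k (yVar l)⁻¹

end

end RepIdentity

open Module

namespace RepIdentity

/-! ### Burnside density and simplicity of `End V`. -/

section Density

variable {k G V : Type*} [Field k] [Group G] [AddCommGroup V] [Module k V]
  (ρ : Representation k G V)

/-! The guard polynomial C_n (`guardPoly`) vanishes under every substitution that identifies two of
y_1, …, y_n. For distinct values of the y_i, the u-variables can be chosen so that a prescribed
nonzero linear map on `End V` does not kill the value of C_n: faithfulness makes each difference
nonzero, `End V` is simple, and group operators span it. In particular C_n is an identity exactly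
when n > |G|, so the identities determine |G|.

Similarity: multiplication by C_m confines an element of kF to injective assignments G → H. If for
each injection b some relation among the σ(b g) failed for ρ, primeness of the kernel of the map
onto `End V` would give a single X vanishing for all b but not for ρ; then X C_m would be an
identity of σ and not of ρ. So some b carries all relations over. It is bijective by equality of
orders, and it induces an isomorphism `End W` → `End V`, which is conjugation by a linear
isomorphism.

Centrality: where C_m survives, the y_l run through G, so c_m takes the value ∑ g A g⁻¹, a scalar by
Schur's lemma. Projectivity enters through Higman's criterion: this trace map is nonzero. -/

theorem finiteDimensional_of_isIrreducible [Finite G] [hρ : ρ.IsIrreducible] :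
    FiniteDimensional k V := by
  have := Fintype.ofFinite G
  have : Nontrivial V := IsSimpleModule.nontrivial (MonoidAlgebra k G) ρ.asModule
  obtain ⟨v, hv⟩ := exists_ne (0 : V)
  let S : Subrepresentation ρ :=
    { toSubmodule := Submodule.span k (Set.range fun g => ρ g v)
      apply_mem_toSubmodule := fun g w hw => by
        induction hw using Submodule.span_induction with
        | mem x hx =>
          obtain ⟨a, rfl⟩ := hx
          exact Submodule.subset_span ⟨g * a, by simp⟩
        | zero => simp
        | add x y _ _ hx hy => rw [map_add]; exact add_mem hx hy
        | smul c x _ hx => rw [map_smul]; exact Submodule.smul_mem _ _ hx }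
  have hvS : v ∈ S.toSubmodule := Submodule.subset_span ⟨1, by simp⟩
  rcases hρ.eq_bot_or_eq_top S with h | h
  · exact absurd (by rw [h] at hvS; exact hvS) hv
  · have : S.toSubmodule = ⊤ := by rw [h]; rfl
    exact ⟨this ▸ Submodule.fg_span (Set.finite_range _)⟩

/-- Burnside's theorem: the operators of an irreducible finite-dimensional representation over an
algebraically closed field span the endomorphism algebra. -/
theorem asAlgebraHom_surjective [IsAlgClosed k] [FiniteDimensional k V] [ρ.IsIrreducible] :
    Function.Surjective ρ.asAlgebraHom := by
  intro f
  have hs := IsSimpleModule.algebraMap_end_bijective_of_isAlgClosed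
    (A := MonoidAlgebra k G) (V := ρ.asModule) k
  have : Module.Finite (End (MonoidAlgebra k G) ρ.asModule) ρ.asModule :=
    Module.Finite.of_restrictScalars_finite k _ _
  -- By Schur's lemma the commutant consists of scalars, so every k-linear map lies in the double
  -- commutant and the density theorem applies.
  let F : End (End (MonoidAlgebra k G) ρ.asModule) ρ.asModule :=
    { toFun := f
      map_add' := f.map_add
      map_smul' := fun c x => by
        obtain ⟨a, rfl⟩ := hs.2 c
        exact f.map_smul a x }
  obtain ⟨r, hr⟩ := Module.Finite.toModuleEnd_moduleEnd_surjective
    (R := MonoidAlgebra k G) (M := ρ.asModule) F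
  refine ⟨r, LinearMap.ext fun v => ?_⟩
  exact congrArg (fun T : End (End (MonoidAlgebra k G) ρ.asModule) ρ.asModule => T v) hr

theorem isSimpleRing_end [FiniteDimensional k V] [Nontrivial V] : IsSimpleRing (End k V) := by
  have : Nonempty (Fin (finrank k V)) := ⟨⟨0, finrank_pos⟩⟩
  exact IsSimpleRing.of_ringEquiv (algEquivMatrix (finBasis k V)).symm.toRingEquiv
    (inferInstance : IsSimpleRing (Matrix (Fin (finrank k V)) (Fin (finrank k V)) k))

/-- An additive map on a simple ring that vanishes on the two-sided ideal generated by a nonzero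
element vanishes. -/
theorem exists_map_mul_mul_ne_zero {R M : Type*} [Ring R] [IsSimpleRing R] [AddCommGroup M]
    (φ : R →+ M) (hφ : φ ≠ 0) {x : R} (hx : x ≠ 0) : ∃ a b, φ (a * x * b) ≠ 0 := by
  by_contra! h
  let I : TwoSidedIdeal R := TwoSidedIdeal.mk' {z | ∀ a b, φ (a * z * b) = 0}
    (by intro a b; simp)
    (by intro y z hy hz a b; rw [mul_add, add_mul, map_add, hy, hz, add_zero])
    (by intro y hy a b; rw [mul_neg, neg_mul, map_neg, hy, neg_zero])
    (by intro y z hz a b; rw [← mul_assoc]; exact hz _ _)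
    (by intro y z hy a b; rw [← mul_assoc, mul_assoc]; exact hy _ _)
  have hI : ∀ z, z ∈ I ↔ ∀ a b, φ (a * z * b) = 0 := fun z => by
    simp only [I, TwoSidedIdeal.mem_mk', Set.mem_ofPred_eq]
  have h1 : (1 : R) ∈ I := IsSimpleRing.one_mem_of_ne_zero_mem I hx ((hI x).2 h)
  exact hφ (AddMonoidHom.ext fun z => by simpa using (hI 1).1 h1 1 z)

theorem exists_apply_operator_ne_zero [IsAlgClosed k] [FiniteDimensional k V] [ρ.IsIrreducible]
    {M : Type*} [AddCommGroup M] [Module k M] (φ : End k V →ₗ[k] M) (hφ : φ ≠ 0) :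
    ∃ g, φ (ρ g) ≠ 0 := by
  by_contra! h
  refine hφ (LinearMap.ext fun T => ?_)
  obtain ⟨r, rfl⟩ := asAlgebraHom_surjective ρ T
  induction r using MonoidAlgebra.induction_linear with
  | zero => simp
  | add f g hf hg => rw [map_add, map_add, hf, hg]; simp
  | single g a => rw [Representation.asAlgebraHom_single, map_smul, h]; simp

/-- A nonzero linear map on `End V` is nonzero on some product that interlaces given nonzero
endomorphisms with operators of the representation. -/
theorem exists_apply_prod_ne_zero [IsAlgClosed k] [FiniteDimensional k V] [ρ.IsIrreducible]
    {M ι : Type*} [AddCommGroup M] [Module k M] [DecidableEq ι] (x : ι → End k V) (l : List ι)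
    (hl : l.Nodup) (hx : ∀ i ∈ l, x i ≠ 0) (φ : End k V →ₗ[k] M) (hφ : φ ≠ 0) :
    ∃ (g : G) (u : ι → G), φ (ρ g * (l.map fun i => x i * ρ (u i)).prod) ≠ 0 := by
  have : Nontrivial V := IsSimpleModule.nontrivial (MonoidAlgebra k G) ρ.asModule
  have := isSimpleRing_end (k := k) (V := V)
  induction l generalizing φ with
  | nil =>
    obtain ⟨g, hg⟩ := exists_apply_operator_ne_zero ρ φ hφ
    exact ⟨g, fun _ => 1, by simpa using hg⟩
  | cons i l ih =>
    obtain ⟨a, b, hab⟩ := exists_map_mul_mul_ne_zero φ.toAddMonoidHom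
      (fun h => hφ (LinearMap.ext fun T => DFunLike.congr_fun h T)) (hx i (by simp))
    -- The left multiplier `a` is replaced by a group operator; the right multiplier `b` then only
    -- witnesses that the map passed to the induction is nonzero.
    have hψ : φ ∘ₗ LinearMap.mulRight k (x i * b) ≠ 0 := fun h =>
      hab (by simpa [mul_assoc] using LinearMap.congr_fun h a)
    obtain ⟨g, hg⟩ := exists_apply_operator_ne_zero ρ _ hψ
    have hχ : φ ∘ₗ LinearMap.mulLeft k (ρ g * x i) ≠ 0 := fun h =>
      hg (by simpa [mul_assoc] using LinearMap.congr_fun h b)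
    obtain ⟨g', u, hu⟩ := ih hl.of_cons (fun j hj => hx j (by simp [hj])) _ hχ
    refine ⟨g, Function.update u i g', ?_⟩
    have hi : i ∉ l := (List.nodup_cons.1 hl).1
    have hmap : (l.map fun j => x j * ρ (Function.update u i g' j)) =
        l.map fun j => x j * ρ (u j) :=
      List.map_congr_left fun j hj => by
        rw [Function.update_of_ne (ne_of_mem_of_not_mem hj hi)]
    rw [List.map_cons, List.prod_cons, hmap, Function.update_self]
    simpa [mul_assoc] using hu

end Density

/-! ### Values of the guard polynomial. -/

section Evaluation

variable {k G V : Type*} [Field k] [Group G] [AddCommGroup V] [Module k V]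
  (ρ : Representation k G V) (h : FreeGroup ℕ →* G)

theorem eval_mul (u v : FreeGroupAlgebra k) : eval ρ h (u * v) = eval ρ h u * eval ρ h v :=
  map_mul _ u v

theorem eval_word (f : FreeGroup ℕ) : eval ρ h (word k f) = ρ (h f) := by
  simp [eval, word]

theorem eval_guardPoly (n : ℕ) :
    eval ρ h (guardPoly k n) = ρ (h uZero) * ((pairs n).map fun p =>
      (ρ (h (yVar p.1)) - ρ (h (yVar p.2))) * ρ (h (uVar p.1 p.2))).prod := by
  rw [guardPoly, eval_mul, eval_word, eval, map_list_prod, List.map_map]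
  congr 3
  ext1 p
  change eval ρ h _ = _
  rw [eval_mul, eval_word]
  congr 1
  rw [eval, map_sub]
  exact congrArg₂ _ (eval_word ρ h _) (eval_word ρ h _)

theorem eval_centralPoly (n : ℕ) :
    eval ρ h (centralPoly k n) = ∑ l ∈ Finset.Icc 1 n,
      ρ (h (yVar l)) * eval ρ h (guardPoly k n) * ρ (h (yVar l))⁻¹ := by
  rw [centralPoly, eval, map_sum]
  refine Finset.sum_congr rfl fun l _ => ?_
  change eval ρ h _ = _
  rw [eval_mul, eval_mul, eval_word, eval_word, map_inv]

theorem mem_pairs {n : ℕ} {p : ℕ × ℕ} : p ∈ pairs n ↔ 1 ≤ p.1 ∧ p.1 < p.2 ∧ p.2 ≤ n := by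
  obtain ⟨i, j⟩ := p
  rw [pairs, List.mem_filter, show (i, j) ∈ List.range' 1 n ×ˢ List.range' 1 n ↔ _ from
    List.pair_mem_product, List.mem_range', List.mem_range', decide_eq_true_eq]
  constructor
  · rintro ⟨⟨⟨i, hi, h1⟩, j, hj, h2⟩, hlt⟩
    omega
  · rintro ⟨h1, h2, h3⟩
    exact ⟨⟨⟨i - 1, by omega, by omega⟩, j - 1, by omega, by omega⟩, h2⟩

theorem nodup_pairs (n : ℕ) : (pairs n).Nodup :=
  (List.Nodup.product List.nodup_range' List.nodup_range').filter _

theorem eval_guardPoly_eq_zero {n : ℕ}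
    (hn : ¬ Set.InjOn (fun i => h (yVar i)) (Finset.Icc 1 n : Finset ℕ)) :
    eval ρ h (guardPoly k n) = 0 := by
  have key : ∃ i j, 1 ≤ i ∧ i < j ∧ j ≤ n ∧ h (yVar i) = h (yVar j) := by
    simp only [Set.InjOn, Finset.coe_Icc, Set.mem_Icc] at hn
    push Not at hn
    obtain ⟨i, hi, j, hj, he, hne⟩ := hn
    rcases lt_or_gt_of_ne hne with hlt | hlt
    · exact ⟨i, j, hi.1, hlt, hj.2, he⟩
    · exact ⟨j, i, hj.1, hlt, hi.2, he.symm⟩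
  obtain ⟨i, j, h1, h2, h3, he⟩ := key
  rw [eval_guardPoly, List.prod_eq_zero, mul_zero]
  exact List.mem_map.2 ⟨(i, j), mem_pairs.2 ⟨h1, h2, h3⟩, by simp [he]⟩

/-- The `u`-variables are free generators distinct from the `yVar`, so they can realise the
interlacing operators while the `y`-values stay prescribed. -/
theorem exists_apply_eval_guardPoly_ne_zero [IsAlgClosed k] [FiniteDimensional k V]
    [ρ.IsIrreducible] (hρ : Function.Injective ρ) {M : Type*} [AddCommGroup M] [Module k M]
    (φ : End k V →ₗ[k] M) (hφ : φ ≠ 0) {n : ℕ} (y : ℕ → G)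
    (hy : Set.InjOn y (Finset.Icc 1 n : Finset ℕ)) :
    ∃ h : FreeGroup ℕ →* G, (∀ i, 1 ≤ i → h (yVar i) = y i) ∧
      φ (eval ρ h (guardPoly k n)) ≠ 0 := by
  obtain ⟨g, u, hu⟩ := exists_apply_prod_ne_zero ρ (fun p : ℕ × ℕ => ρ (y p.1) - ρ (y p.2))
    (pairs n) (nodup_pairs n) (fun p hp h0 => by
      obtain ⟨h1, h2, h3⟩ := mem_pairs.1 hp
      have := hy (by simp; omega) (by simp; omega) (hρ (sub_eq_zero.1 h0))
      omega) φ hφ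
  -- The code (0, 0) of `uZero` lies on the diagonal, hence is tested before the diagonal codes of
  -- the `yVar`.
  let h : FreeGroup ℕ →* G := FreeGroup.lift fun s =>
    if s = Nat.pair 0 0 then g
    else if s.unpair.1 = s.unpair.2 then y s.unpair.1 else u s.unpair
  have hyv : ∀ i, 1 ≤ i → h (yVar i) = y i := fun i hi => by
    have : Nat.pair i i ≠ Nat.pair 0 0 := fun e => by
      rw [Nat.pair_eq_pair] at e; omega
    simp only [h, yVar, FreeGroup.lift_apply_of, if_neg this, Nat.unpair_pair, if_true]
  refine ⟨h, hyv, ?_⟩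
  have h0 : h uZero = g := by simp only [h, uZero, FreeGroup.lift_apply_of, if_true]
  rw [eval_guardPoly, h0]
  convert hu using 4
  refine List.map_congr_left fun p hp => ?_
  obtain ⟨h1, h2, h3⟩ := mem_pairs.1 hp
  have hne : Nat.pair p.1 p.2 ≠ Nat.pair 0 0 := fun e => by
    rw [Nat.pair_eq_pair] at e; omega
  rw [hyv _ h1, hyv _ (by omega)]
  simp only [h, uVar, FreeGroup.lift_apply_of, if_neg hne, Nat.unpair_pair, if_neg h2.ne]

end Evaluation

/-! ### The trace map, Higman's criterion and the central polynomial. -/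

section Central

/-- An enumeration of a finite type by `1, …, n`, extended arbitrarily to `ℕ`. -/
theorem exists_enumeration (G : Type*) [Finite G] [Nonempty G] : ∃ (y : ℕ → G) (pos : G → ℕ),
    Set.InjOn y (Finset.Icc 1 (Nat.card G) : Finset ℕ) ∧
      ∀ g, pos g ∈ Finset.Icc 1 (Nat.card G) ∧ y (pos g) = g := by
  obtain ⟨e⟩ : Nonempty (G ≃ Fin (Nat.card G)) := ⟨Finite.equivFin G⟩
  refine ⟨fun i => if hi : i - 1 < Nat.card G then e.symm ⟨i - 1, hi⟩ else Classical.arbitrary G,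
    fun g => e g + 1, ?_, fun g => ⟨?_, by simp⟩⟩
  · intro i hi j hj hij
    simp only [Finset.coe_Icc, Set.mem_Icc] at hi hj
    simp only at hij
    rw [dif_pos (by omega), dif_pos (by omega)] at hij
    have := Fin.mk.inj_iff.1 (e.symm.injective hij)
    omega
  · exact Finset.mem_Icc.2 ⟨Nat.succ_pos _, (e g).isLt⟩

variable {k G V : Type*} [Field k] [Group G] [AddCommGroup V] [Module k V]
  (ρ : Representation k G V)

/-- The trace map `A ↦ ∑ g, ρ(g) A ρ(g)⁻¹` of `End V`. -/
noncomputable def conjSum [Fintype G] : End k V →ₗ[k] End k V :=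
  ∑ g : G, LinearMap.mulLeft k (ρ g) ∘ₗ LinearMap.mulRight k (ρ g⁻¹)

theorem conjSum_apply [Fintype G] (A : End k V) :
    conjSum ρ A = ∑ g : G, ρ g * A * ρ g⁻¹ := by
  simp [conjSum, mul_assoc]

/-- Schur's lemma for the values of the trace map. -/
theorem exists_conjSum_eq_smul_one [Fintype G] [IsAlgClosed k] [FiniteDimensional k V]
    [ρ.IsIrreducible] (A : End k V) : ∃ a : k, conjSum ρ A = a • (1 : End k V) := by
  have hcomm : ∀ x, conjSum ρ A * ρ x = ρ x * conjSum ρ A := fun x => by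
    rw [conjSum_apply, Finset.sum_mul, Finset.mul_sum]
    refine Fintype.sum_equiv (Equiv.mulLeft x⁻¹) _ _ fun g => ?_
    simp only [Equiv.coe_mulLeft, ← mul_assoc, ← map_mul, mul_inv_rev, inv_inv, mul_inv_cancel,
      one_mul]
    rw [mul_assoc, ← map_mul]
  obtain ⟨a, ha⟩ := (Representation.IsIrreducible.algebraMap_intertwiningMap_bijective_of_isAlgClosed
    (ρ := ρ)).2 ⟨conjSum ρ A, hcomm⟩
  exact ⟨a, (congrArg Representation.IntertwiningMap.toLinearMap
    ((Algebra.algebraMap_eq_smul_one a).symm.trans ha)).symm⟩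

/-- Higman's criterion: on a projective module the identity is a value of the trace map. -/
theorem exists_conjSum_eq_one [Fintype G]
    (hproj : Module.Projective (MonoidAlgebra k G) ρ.asModule) :
    ∃ A : End k V, conjSum ρ A = 1 := by
  classical
  obtain ⟨s, hs⟩ := hproj.out
  -- `C` keeps only the coefficient at 1 of each coordinate. Averaging over translates recovers
  -- every coefficient, so the trace of `C` is the canonical projection, split by `s`.
  let C : (ρ.asModule →₀ MonoidAlgebra k G) →ₗ[k] ρ.asModule :=
    Finsupp.lsum k fun w => LinearMap.toSpanSingleton k _ w ∘ₗ Finsupp.lapply 1 ∘ₗ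
      (MonoidAlgebra.coeffLinearEquiv k).toLinearMap
  have hC : ∀ f, ∑ g : G, MonoidAlgebra.of k G g • C (MonoidAlgebra.of k G g⁻¹ • f) =
      Finsupp.linearCombination (MonoidAlgebra k G) id f := by
    intro f
    induction f using Finsupp.induction_linear with
    | zero => simp
    | add f g hf hg => simp only [smul_add, map_add, Finset.sum_add_distrib, hf, hg]
    | single w r =>
      induction r using MonoidAlgebra.induction_linear with
      | zero => simp
      | add r t hr ht =>
        simp only [Finsupp.single_add, smul_add, map_add, Finset.sum_add_distrib, hr, ht]
      | single x a =>
        rw [Finset.sum_eq_single x]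
        · simp [C]
          rfl
        · intro g _ hg
          have : g⁻¹ * x ≠ 1 := fun h => hg (inv_mul_eq_one.1 h)
          simp [C, Finsupp.single_eq_of_ne' this]
        · simp
  refine ⟨ρ.asModuleEquiv.toLinearMap ∘ₗ C ∘ₗ s.restrictScalars k ∘ₗ
    ρ.asModuleEquiv.symm.toLinearMap, LinearMap.ext fun v => ?_⟩
  rw [conjSum_apply, LinearMap.sum_apply]
  have := congrArg ρ.asModuleEquiv (hC (s (ρ.asModuleEquiv.symm v)))
  rw [hs, LinearEquiv.apply_symm_apply, map_sum] at this
  refine Eq.trans (Finset.sum_congr rfl fun g _ => ?_) this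
  rw [End.mul_apply, End.mul_apply, Representation.asModuleEquiv_map_smul,
    Representation.asAlgebraHom_of]
  simp only [LinearMap.comp_apply, LinearEquiv.coe_coe, LinearMap.restrictScalars_apply,
    Representation.asModuleEquiv_symm_map_rho, map_smul]

theorem isCentralPolynomial_centralPoly [Finite G] [IsAlgClosed k] [ρ.IsIrreducible]
    (hρ : Function.Injective ρ) (hproj : Module.Projective (MonoidAlgebra k G) ρ.asModule) :
    IsCentralPolynomial ρ (centralPoly k (Nat.card G)) := by
  have := Fintype.ofFinite G
  have := finiteDimensional_of_isIrreducible ρ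
  have : Nontrivial V := IsSimpleModule.nontrivial (MonoidAlgebra k G) ρ.asModule
  have heval : ∀ h : FreeGroup ℕ →* G,
      Set.InjOn (fun i => h (yVar i)) (Finset.Icc 1 (Nat.card G) : Finset ℕ) →
      eval ρ h (centralPoly k (Nat.card G)) = conjSum ρ (eval ρ h (guardPoly k (Nat.card G))) := by
    intro h hinj
    classical
    have him : (Finset.Icc 1 (Nat.card G)).image (fun i => h (yVar i)) = Finset.univ := by
      rw [← Finset.card_eq_iff_eq_univ, Finset.card_image_of_injOn hinj]
      simp
    rw [eval_centralPoly, conjSum_apply, ← him, Finset.sum_image hinj]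
  constructor
  · intro hid
    obtain ⟨A, hA⟩ := exists_conjSum_eq_one ρ hproj
    have hne : conjSum ρ ≠ 0 := fun h => one_ne_zero (by rw [← hA, h]; rfl)
    obtain ⟨y, -, hinj, -⟩ := exists_enumeration G
    obtain ⟨h, -, hh⟩ := exists_apply_eval_guardPoly_ne_zero ρ hρ (conjSum ρ) hne y hinj
    refine hh ?_
    rw [← heval h, hid h]
    -- The nonzero guard value itself forces the assignment to be injective.
    by_contra hinj
    exact hh (by rw [eval_guardPoly_eq_zero ρ h hinj, map_zero])
  · intro h
    by_cases hinj : Set.InjOn (fun i => h (yVar i)) (Finset.Icc 1 (Nat.card G) : Finset ℕ)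
    · rw [heval h hinj]
      exact exists_conjSum_eq_smul_one ρ _
    · refine ⟨0, ?_⟩
      rw [eval_centralPoly, eval_guardPoly_eq_zero ρ h hinj]
      simp

end Central

/-! ### Reconstruction of the group and the representation from the identities. -/

section Similarity

variable {k G H I V W : Type*} [Field k] [Group G] [Group H] [AddCommGroup V] [Module k V]
  [AddCommGroup W] [Module k W]

theorem not_isIdentity_guardPoly [Finite G] [IsAlgClosed k] (ρ : Representation k G V)
    [ρ.IsIrreducible] (hρ : Function.Injective ρ) {n : ℕ} (hn : n ≤ Nat.card G) :
    ¬ IsIdentity ρ (guardPoly k n) := by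
  have := finiteDimensional_of_isIrreducible ρ
  have : Nontrivial V := IsSimpleModule.nontrivial (MonoidAlgebra k G) ρ.asModule
  obtain ⟨y, -, hy, -⟩ := exists_enumeration G
  obtain ⟨h, -, hh⟩ := exists_apply_eval_guardPoly_ne_zero ρ hρ LinearMap.id
    (fun h => one_ne_zero (LinearMap.congr_fun h (1 : End k V))) (n := n) y
    (hy.mono (Finset.coe_subset.2 (Finset.Icc_subset_Icc_right hn)))
  exact fun hid => hh (hid h)

theorem isIdentity_guardPoly [Finite G] (ρ : Representation k G V) {n : ℕ}
    (hn : Nat.card G < n) : IsIdentity ρ (guardPoly k n) := by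
  have := Fintype.ofFinite G
  refine fun h => eval_guardPoly_eq_zero ρ h fun hinj => ?_
  have := Finset.card_le_card_of_injOn (t := Finset.univ) _ (fun _ _ => Finset.mem_univ _) hinj
  rw [Nat.card_Icc, Finset.card_univ, ← Nat.card_eq_fintype_card] at this
  omega

/-- The group order is determined by the identities of a faithful irreducible representation. -/
theorem card_le_of_forall_isIdentity [Finite G] [Finite H] [IsAlgClosed k]
    (ρ : Representation k G V) (σ : Representation k H W) [σ.IsIrreducible]
    (hσ : Function.Injective σ)
    (hsame : ∀ u : FreeGroupAlgebra k, IsIdentity ρ u → IsIdentity σ u) :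
    Nat.card H ≤ Nat.card G := by
  by_contra! hlt
  exact not_isIdentity_guardPoly σ hσ (Nat.succ_le_of_lt hlt)
    (hsame _ (isIdentity_guardPoly ρ (Nat.lt_succ_self _)))

/-- The extension of a map `b : I → H` followed by a representation of `H` to the group algebra
of the free group on `I`. -/
noncomputable def freeLift (σ : Representation k H W) (b : I → H) :
    MonoidAlgebra k (FreeGroup I) →ₐ[k] End k W :=
  MonoidAlgebra.lift k (End k W) (FreeGroup I) (σ.comp (FreeGroup.lift b))

theorem freeLift_of (σ : Representation k H W) (b : I → H) (w : FreeGroup I) :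
    freeLift σ b (MonoidAlgebra.of k _ w) = σ (FreeGroup.lift b w) := by
  simp [freeLift]

theorem eval_mapDomain (σ : Representation k H W) (h : FreeGroup ℕ →* H) (y : I → FreeGroup ℕ)
    (X : MonoidAlgebra k (FreeGroup I)) :
    eval σ h (MonoidAlgebra.mapDomainAlgHom k k (FreeGroup.lift y) X) =
      freeLift σ (fun g => h (y g)) X := by
  induction X using MonoidAlgebra.induction_linear with
  | zero => simp [eval]
  | add f g hf hg => simp only [eval, map_add] at *; rw [hf, hg]
  | single w a =>
    have : h.comp (FreeGroup.lift y) = FreeGroup.lift fun g => h (y g) := by ext; simp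
    simp [eval, freeLift, ← this]

theorem freeLift_surjective [IsAlgClosed k] [FiniteDimensional k W] (σ : Representation k H W)
    [σ.IsIrreducible] {b : I → H} (hb : Function.Surjective b) :
    Function.Surjective (freeLift σ b) := by
  intro T
  obtain ⟨r, rfl⟩ := asAlgebraHom_surjective σ T
  induction r using MonoidAlgebra.induction_linear with
  | zero => exact ⟨0, by simp⟩
  | add f g hf hg =>
    obtain ⟨x, hx⟩ := hf
    obtain ⟨y, hy⟩ := hg
    exact ⟨x + y, by rw [map_add, map_add, hx, hy]⟩
  | single g a =>
    obtain ⟨x, rfl⟩ := hb g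
    refine ⟨a • MonoidAlgebra.of k _ (FreeGroup.of x), ?_⟩
    rw [map_smul, freeLift_of, FreeGroup.lift_apply_of, Representation.asAlgebraHom_single]

/-- The kernel of a surjection onto a simple ring is prime: it does not contain a finite
intersection of ideals none of which it contains. -/
theorem exists_forall_map_eq_zero_and_map_ne_zero {A R ι : Type*} {S : ι → Type*} [Ring A] [Ring R]
    [IsSimpleRing R] [∀ i, Ring (S i)] (f : A →+* R) (hf : Function.Surjective f)
    (g : ∀ i, A →+* S i) (s : Finset ι) (h : ∀ i ∈ s, ∃ x, g i x = 0 ∧ f x ≠ 0) :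
    ∃ x, (∀ i ∈ s, g i x = 0) ∧ f x ≠ 0 := by
  classical
  induction s using Finset.induction_on with
  | empty => exact ⟨1, by simp, by simp⟩
  | insert i s _ ih =>
    obtain ⟨x, hx, hfx⟩ := ih fun j hj => h j (Finset.mem_insert_of_mem hj)
    obtain ⟨z, hz, hfz⟩ := h i (Finset.mem_insert_self _ _)
    -- Primeness of a simple ring: f(x) R f(z) ≠ 0. Lifting the middle factors to `A` gives a
    -- product killed by every `g j`.
    obtain ⟨a, b, hab⟩ := exists_map_mul_mul_ne_zero (AddMonoidHom.mulLeft (f x))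
      (fun h0 => hfx (by simpa using DFunLike.congr_fun h0 1)) hfz
    obtain ⟨a, rfl⟩ := hf a
    obtain ⟨b, rfl⟩ := hf b
    refine ⟨x * (a * z * b), fun j hj => ?_, by simpa using hab⟩
    rcases Finset.mem_insert.1 hj with rfl | hj
    · simp [hz]
    · simp [hx j hj]

/-- If every identity of `σ` is an identity of `ρ`, then some injection `b : G → H` turns every
relation of `σ` between the operators `σ (b g)` into a relation of `ρ`. -/
theorem exists_injective_forall_freeLift_eq_zero [Finite G] [Finite H] [IsAlgClosed k]
    (ρ : Representation k G V) (σ : Representation k H W) [ρ.IsIrreducible]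
    (hρ : Function.Injective ρ)
    (hsame : ∀ u : FreeGroupAlgebra k, IsIdentity σ u → IsIdentity ρ u) :
    ∃ b : G → H, Function.Injective b ∧ ∀ X, freeLift σ b X = 0 → freeLift ρ id X = 0 := by
  classical
  have := finiteDimensional_of_isIrreducible ρ
  have : Nontrivial V := IsSimpleModule.nontrivial (MonoidAlgebra k G) ρ.asModule
  have := isSimpleRing_end (k := k) (V := V)
  by_contra! hcon
  have := Fintype.ofFinite {b : G → H // Function.Injective b}
  obtain ⟨X, hX, hne⟩ := exists_forall_map_eq_zero_and_map_ne_zero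
    (freeLift ρ id).toRingHom (freeLift_surjective ρ Function.surjective_id)
    (fun b : {b : G → H // Function.Injective b} => (freeLift σ b.1).toRingHom) Finset.univ
    (fun b _ => hcon b.1 b.2)
  obtain ⟨y, pos, hy, hpos⟩ := exists_enumeration G
  -- Non-injective assignments kill the guard factor; the injective ones restrict to an injection `G
  -- → H`, which kills `X`.
  have hid : IsIdentity σ (MonoidAlgebra.mapDomainAlgHom k k
      (FreeGroup.lift fun g => yVar (pos g)) X * guardPoly k (Nat.card G)) := by
    intro h
    rw [eval_mul, eval_mapDomain]
    by_cases hinj : Set.InjOn (fun i => h (yVar i)) (Finset.Icc 1 (Nat.card G) : Finset ℕ)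
    · have hb : Function.Injective fun g => h (yVar (pos g)) := fun g g' hg => by
        rw [← (hpos g).2, ← (hpos g').2, hinj (hpos g).1 (hpos g').1 hg]
      have : freeLift σ (fun g => h (yVar (pos g))) X = 0 := hX ⟨_, hb⟩ (Finset.mem_univ _)
      rw [this, zero_mul]
    · rw [eval_guardPoly_eq_zero σ h hinj, mul_zero]
  obtain ⟨h, hhy, hh⟩ := exists_apply_eval_guardPoly_ne_zero ρ hρ
    (LinearMap.mulLeft k (freeLift ρ id X)) (fun h0 => hne (by
      simpa using LinearMap.congr_fun h0 (1 : End k V))) y hy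
  have hv : (fun g => h (yVar (pos g))) = id := funext fun g => by
    rw [hhy _ (Finset.mem_Icc.1 (hpos g).1).1, (hpos g).2, id]
  have := hsame _ hid h
  rw [eval_mul, eval_mapDomain, hv] at this
  exact hh this

theorem similar_of_sameIdentities [Finite G] [Finite H] [IsAlgClosed k]
    (ρ : Representation k G V) (σ : Representation k H W) [ρ.IsIrreducible] [σ.IsIrreducible]
    (hρ : Function.Injective ρ) (hσ : Function.Injective σ) (hsame : SameIdentities ρ σ) :
    Similar ρ σ := by
  have := finiteDimensional_of_isIrreducible ρ
  have := finiteDimensional_of_isIrreducible σ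
  have : Nontrivial V := IsSimpleModule.nontrivial (MonoidAlgebra k G) ρ.asModule
  have : Nontrivial W := IsSimpleModule.nontrivial (MonoidAlgebra k H) σ.asModule
  have := isSimpleRing_end (k := k) (V := W)
  have := Fintype.ofFinite G
  have := Fintype.ofFinite H
  obtain ⟨b, hb, hker⟩ := exists_injective_forall_freeLift_eq_zero ρ σ hρ fun u => (hsame u).2
  have hcard : Nat.card H ≤ Nat.card G :=
    card_le_of_forall_isIdentity ρ σ hσ fun u => (hsame u).1
  have hbij : Function.Bijective b := hb.bijective_of_nat_card_le hcard
  have hsurj := freeLift_surjective σ hbij.2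
  have hwd : ∀ X Y, freeLift σ b X = freeLift σ b Y → freeLift ρ id X = freeLift ρ id Y :=
    fun X Y h => by
      rw [← sub_eq_zero, ← map_sub] at h ⊢
      exact hker _ h
  let r := Function.surjInv hsurj
  have hr : ∀ X, freeLift ρ id (r (freeLift σ b X)) = freeLift ρ id X := fun X =>
    hwd _ _ (Function.surjInv_eq hsurj _)
  have hr' : ∀ T, freeLift σ b (r T) = T := Function.surjInv_eq hsurj
  -- The map sending σ(b g) to ρ(g): lift an operator to the free group algebra and evaluate in `ρ`.
  -- By `hwd` the lift does not matter.
  let τ : End k W →ₐ[k] End k V := AlgHom.ofLinearMap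
    { toFun := fun T => freeLift ρ id (r T)
      map_add' := fun S T => by
        rw [← map_add]
        exact hwd _ _ (by rw [map_add, hr', hr', hr'])
      map_smul' := fun c T => by
        rw [RingHom.id_apply, ← map_smul]
        exact hwd _ _ (by rw [map_smul, hr', hr']) }
    (by
      rw [← map_one (freeLift ρ id)]
      exact hwd _ _ (by rw [hr', map_one]))
    (fun S T => by
      change freeLift ρ id _ = freeLift ρ id _ * freeLift ρ id _
      rw [← map_mul]
      exact hwd _ _ (by rw [map_mul, hr', hr', hr']))
  have hτ : ∀ X, τ (freeLift σ b X) = freeLift ρ id X := hr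
  have hτbij : Function.Bijective τ := ⟨τ.toRingHom.injective, fun T => by
    obtain ⟨X, rfl⟩ := freeLift_surjective ρ Function.surjective_id T
    exact ⟨_, hτ X⟩⟩
  -- Skolem–Noether: an isomorphism of endomorphism algebras is conjugation by a linear isomorphism.
  obtain ⟨e, he⟩ := (AlgEquiv.ofBijective τ hτbij).symm.eq_linearEquivConjAlgEquiv
  have hconj : ∀ g, σ (b g) = e.conjAlgEquiv k (ρ g) := fun g => by
    rw [← he, AlgEquiv.eq_symm_apply]
    have := hτ (MonoidAlgebra.of k _ (FreeGroup.of g))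
    rw [freeLift_of, freeLift_of, FreeGroup.lift_apply_of, FreeGroup.lift_apply_of] at this
    exact this
  refine ⟨{ Equiv.ofBijective b hbij with
    map_mul' := fun x y => hσ ?_ }, e, fun g v => ?_⟩
  -- `b` was only a bijection; it is multiplicative because `σ` is faithful and g ↦ σ(b g) is a
  -- conjugate of `ρ`.
  · change σ (b (x * y)) = σ (b x * b y)
    rw [map_mul, hconj, hconj, hconj, map_mul, map_mul]
  · change _ = σ (b g) (e v)
    simp [hconj]

end Similarity

end RepIdentity

theorem theorem1p1
    {k : Type*} [Field k] [IsAlgClosed k]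
    {G : Type*} [Group G] [Finite G] {H : Type*} [Group H] [Finite H]
    {V : Type*} [AddCommGroup V] [Module k V] {W : Type*} [AddCommGroup W] [Module k W]
    (ρ : Representation k G V) (σ : Representation k H W)
    (hρ : ρ.IsIrreducible) (hσ : σ.IsIrreducible)
    (hρ_exact : Function.Injective ρ) (hσ_exact : Function.Injective σ)
    (hsame : RepIdentity.SameIdentities ρ σ)
    (hproj : Module.Projective (MonoidAlgebra k G) ρ.asModule) :
    RepIdentity.Similar ρ σ ∧
      RepIdentity.IsCentralPolynomial ρ (RepIdentity.centralPoly k (Nat.card G)) :=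
  ⟨RepIdentity.similar_of_sameIdentities ρ σ hρ_exact hσ_exact hsame,
    RepIdentity.isCentralPolynomial_centralPoly ρ hρ_exact hproj⟩
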